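/- Let $b\ge 2$ be an integer. A base $b$ over-expansion of a positive integer $N$ is a word $d_r d_{r-1}\cdots d_0$ over the alphabet $\{0,1,\dots,b\}$ with $d_r\ne 0$ and $\sum_{i=0}^{r} d_i b^i=N$. Let $s_b(0)=0$, $s_b(1)=1$, and, for $n\ge 2$, let $s_b(n)$ be the number of base $b$ over-expansions of $n-1$. Let $F_j$ denote the Fibonacci numbers, $F_1=F_2=1$ and $F_{j+2}=F_{j+1}+F_j$. Put $h_1=h_2=1$ and \[ h_m=1+\sum_{i=0}^{\lfloor (m-3)/2\rfloor} b^{\,m-2-2i}\qquad (m\ge 3). \] For integers $2\le m\le k$ put $G_k(m)=b^k+h_m$ and $H_k(m)=F_{m+2}+(k-m)F_m$. For integers $2\le m<k$ let $J_{k,m}:\mathbb R\to\mathbb R$, \[ J_{k,m}(x)=\frac{H_k(m+1)-H_k(m)}{G_k(m+1)-G_k(m)}\,\bigl(x-G_k(m)\bigr)+H_k(m), \] be the function whose graph is the line through $(G_k(m),H_k(m))$ and $(G_k(m+1),H_k(m+1))$. If $k$, $m$ and $n$ are integers such that $2\le m<k$ and $G_k(m)<n<G_k(m+1)$, then \[ s_b(n)<J_{k,m}(n).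 \] -/

import Mathlib

namespace SternBound

/-- The base `b` over-expansions of `N`: words `d_k ⋯ d_1 d_0` over the alphabet `{0, 1, …, b}`
with leading letter `d_k ≠ 0` and `∑ d_i b^i = N`. A word is stored with the least significant
letter first, as the nonempty list `[d_0, d_1, …, d_k]`. -/
def overExpansions (b N : ℕ) : Set (List ℕ) :=
  {L | (∀ d ∈ L, d ≤ b) ∧ (∃ h : L ≠ [], L.getLast h ≠ 0) ∧ Nat.ofDigits b L = N}

/-- For `b ≥ 2` there are only finitely many over-expansions, so that counting them with
`Set.ncard` is meaningful. -/
theorem overExpansions_finite {b : ℕ} (hb : 2 ≤ b) (N : ℕ) : (overExpansions b N).Finite := by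
  have key : ∀ L : List ℕ, ∀ h : L ≠ [], L.getLast h ≠ 0 → L.length ≤ Nat.ofDigits b L := by
    intro L
    induction L with
    | nil => intro h; exact absurd rfl h
    | cons d L ih =>
      intro h hlast
      rcases eq_or_ne L [] with rfl | hL
      · simp only [List.getLast_singleton] at hlast
        simp only [List.length_singleton, Nat.ofDigits_singleton]
        omega
      · rw [List.getLast_cons hL] at hlast
        have h1 := ih hL hlast
        have h2 : 1 ≤ L.length := List.length_pos_iff.mpr hL
        have h3 : 2 * Nat.ofDigits b L ≤ b * Nat.ofDigits b L := Nat.mul_le_mul_right _ hb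
        rw [Nat.ofDigits_cons, List.length_cons]
        omega
  have hfin : {L : List (Fin (b + 1)) | L.length ≤ N}.Finite := List.finite_length_le _ N
  refine (hfin.image (List.map Fin.val)).subset ?_
  rintro L ⟨hd, ⟨hne, hlast⟩, hN⟩
  refine ⟨L.pmap (fun d hd => (⟨d, hd⟩ : Fin (b + 1)))
    (fun d hdL => Nat.lt_succ_of_le (hd d hdL)), ?_, ?_⟩
  · simpa using (key L hne hlast).trans hN.le
  · simp [List.map_pmap]

/-- The generalized Stern sequence `s_b(n)`: the number of base `b` over-expansions of `n - 1` for
`n ≥ 2`, with the conventions `s_b(0) = 0` and `s_b(1) = 1`. -/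
noncomputable def s (b : ℕ) : ℕ → ℕ
  | 0 => 0
  | 1 => 1
  | n + 2 => (overExpansions b (n + 1)).ncard

/-- `h_1 = h_2 = 1` and `h_m = 1 + ∑_{i=0}^{⌊(m-3)/2⌋} b^(m-2-2i)` for `m ≥ 3`. -/
def h (b m : ℕ) : ℕ :=
  if m ≤ 2 then 1 else 1 + ∑ i ∈ Finset.range ((m - 3) / 2 + 1), b ^ (m - 2 - 2 * i)

/-- `G_k(m) = b^k + h_m`. -/
def G (b k m : ℕ) : ℕ := b ^ k + h b m

/-- `H_k(m) = F_{m+2} + (k - m) F_m`. -/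
def H (k m : ℕ) : ℤ := Nat.fib (m + 2) + ((k : ℤ) - m) * Nat.fib m

/-- The line through the points `(G_k(m), H_k(m))` and `(G_k(m+1), H_k(m+1))`. -/
noncomputable def J (b k m : ℕ) (x : ℝ) : ℝ :=
  ((H k (m + 1) : ℝ) - H k m) / ((G b k (m + 1) : ℝ) - G b k m) * (x - G b k m) + H k m

end SternBound

/-! Write n = b^k + t with h_m < t < h_{m+1}. Removing the last digit gives s(bN) = s(N), s(bN+1) =
s(N) + s(N+1), and s(bN+r) = s(N+1) for 2 ≤ r ≤ b. Hence values on a block of length b^j depend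
linearly on (s(q), s(q+1)) (`s_split`), and in particular s(b^k + t) = s(b^m + t) + (k-m) s(t)
(`s_pow_add`). The first summand is at most F_{m+2} (`s_le_fib`). Since F_{m+3} = F_{m+2} + F_{m+1},
the function J_{k,m} is F_{m+2} plus k-m times the line through (h_m, F_m) and (h_{m+1}, F_{m+1}),
so it suffices that s(t) lies below this line (`s_lt_line`).

For t ≤ b^(m-1) the bound F_m is enough, because the line rises. Otherwise t shares its leading
powers b^(m-1), b^(m-3), ... with h_{m+1} and then falls short of the next one. This costs s(t) a
product of Fibonacci numbers relative to F_{m+1} (`s_evenRepunit_mul_pow_add_le`), while t is so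
close to h_{m+1} that the line has dropped by less (`s_block_lt`). -/

namespace SternBound

/-! ### Recurrences from the last digit -/

/-- The base `b` over-expansions of `N`, where the empty word is the over-expansion of `0`. -/
def words (b N : ℕ) : Set (List ℕ) :=
  {L | (∀ d ∈ L, d ≤ b) ∧ (∀ h : L ≠ [], L.getLast h ≠ 0) ∧ Nat.ofDigits b L = N}

theorem words_finite {b : ℕ} (hb : 2 ≤ b) (N : ℕ) : (words b N).Finite := by
  refine ((overExpansions_finite hb N).insert []).subset ?_
  rintro L ⟨h1, h2, h3⟩
  rcases eq_or_ne L [] with rfl | hL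
  · exact Set.mem_insert _ _
  · exact Set.mem_insert_of_mem _ ⟨h1, ⟨hL, h2 hL⟩, h3⟩

theorem words_succ (b N : ℕ) : words b (N + 1) = overExpansions b (N + 1) := by
  ext L
  constructor
  · rintro ⟨h1, h2, h3⟩
    rcases eq_or_ne L [] with rfl | hL
    · simp at h3
    · exact ⟨h1, ⟨hL, h2 hL⟩, h3⟩
  · rintro ⟨h1, ⟨hL, h2⟩, h3⟩
    exact ⟨h1, fun _ => h2, h3⟩

theorem cons_mem_words {b N d : ℕ} {L : List ℕ} :
    d :: L ∈ words b N ↔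
      d ≤ b ∧ (L = [] → d ≠ 0) ∧ L ∈ words b (Nat.ofDigits b L) ∧ d + b * Nat.ofDigits b L = N := by
  rcases eq_or_ne L [] with rfl | hL
  · simp [words]
  · simp [words, hL, List.getLast_cons hL, Nat.ofDigits_cons]
    tauto

theorem nil_mem_words {b N : ℕ} : [] ∈ words b N ↔ N = 0 := by
  simp [words, eq_comm]

theorem words_zero {b : ℕ} (hb : 2 ≤ b) : words b 0 = {[]} := by
  ext L
  rw [Set.mem_singleton_iff]
  constructor
  · induction L with
    | nil => exact fun _ => rfl
    | cons d L ih =>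
      intro h
      obtain ⟨-, h2, h3, h4⟩ := cons_mem_words.1 h
      have h5 : d = 0 := by omega
      have h6 : Nat.ofDigits b L = 0 := by
        rcases Nat.mul_eq_zero.1 (show b * Nat.ofDigits b L = 0 by omega) with h | h
        · omega
        · exact h
      rw [h6] at h3
      exact absurd h5 (h2 (ih h3))
  · rintro rfl
    exact nil_mem_words.2 rfl

/-- The empty word realises the convention s_b(1) = 1, so one formula covers all positive arguments.
-/
theorem s_succ {b : ℕ} (hb : 2 ≤ b) (n : ℕ) : s b (n + 1) = (words b n).ncard := by
  cases n with
  | zero => rw [words_zero hb, Set.ncard_singleton]; rfl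
  | succ n => rw [words_succ]; rfl

theorem words_mul_add {b N r : ℕ} (hr0 : 0 < r) (hr : r < b) :
    words b (b * N + r) = List.cons r '' words b N := by
  ext L
  constructor
  · intro h
    cases L with
    | nil => rw [nil_mem_words] at h; omega
    | cons d L =>
      obtain ⟨h1, -, h3, h4⟩ := cons_mem_words.1 h
      have hd : d = r := by
        rcases h1.lt_or_eq with h1 | rfl
        · have := congrArg (· % b) h4
          simpa [Nat.mul_add_mod, Nat.mod_eq_of_lt h1, Nat.mod_eq_of_lt hr] using this
        · have := congrArg (· % d) h4
          simp [Nat.mod_eq_of_lt hr] at this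
          omega
      subst hd
      have : Nat.ofDigits b L = N := Nat.eq_of_mul_eq_mul_left (by omega : 0 < b) (by omega)
      exact ⟨L, this ▸ h3, rfl⟩
  · rintro ⟨L, h, rfl⟩
    have h3 : Nat.ofDigits b L = N := h.2.2
    refine cons_mem_words.2 ⟨hr.le, fun _ => by omega, h3.symm ▸ h, ?_⟩
    rw [h3, add_comm]

/-- Only the digits 0 and b are divisible by b; a final b borrows one unit from the higher places.
-/
theorem words_mul {b : ℕ} (hb : 2 ≤ b) (N : ℕ) :
    words b (b * (N + 1)) = List.cons 0 '' words b (N + 1) ∪ List.cons b '' words b N := by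
  ext L
  constructor
  · intro h
    cases L with
    | nil =>
      rw [nil_mem_words, mul_eq_zero] at h
      omega
    | cons d L =>
      obtain ⟨h1, h2, h3, h4⟩ := cons_mem_words.1 h
      have hd : d = 0 ∨ d = b := by
        rcases h1.lt_or_eq with h1 | h1
        · have := congrArg (· % b) h4
          left
          simpa [Nat.mod_eq_of_lt h1] using this
        · exact Or.inr h1
      rcases hd with rfl | rfl
      · left
        have : Nat.ofDigits b L = N + 1 :=
          Nat.eq_of_mul_eq_mul_left (by omega : 0 < b) (by omega)
        exact ⟨L, this ▸ h3, rfl⟩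
      · right
        have : Nat.ofDigits d L = N := by
          apply Nat.eq_of_mul_eq_mul_left (by omega : 0 < d)
          rw [mul_add] at h4
          omega
        exact ⟨L, this ▸ h3, rfl⟩
  · rintro (⟨L, h, rfl⟩ | ⟨L, h, rfl⟩)
    · have h3 : Nat.ofDigits b L = N + 1 := h.2.2
      refine cons_mem_words.2 ⟨by omega, ?_, h3.symm ▸ h, by rw [h3, zero_add]⟩
      rintro rfl
      simp at h3
    · have h3 : Nat.ofDigits b L = N := h.2.2
      exact cons_mem_words.2 ⟨le_rfl, fun _ => by omega, h3.symm ▸ h, by rw [h3]; ring⟩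

/-- The endpoint `e + 2 = b` is admitted because it yields `s_mul`. -/
theorem s_mul_add {b : ℕ} (hb : 2 ≤ b) (N e : ℕ) (he : e + 2 ≤ b) :
    s b (b * N + e + 2) = s b (N + 1) := by
  rw [show b * N + e + 2 = b * N + (e + 1) + 1 by ring, s_succ hb, s_succ hb,
    words_mul_add (by omega) (by omega), Set.ncard_image_of_injective _ List.cons_injective]

theorem s_mul {b : ℕ} (hb : 2 ≤ b) (N : ℕ) : s b (b * N) = s b N := by
  cases N with
  | zero => rfl
  | succ N =>
    rw [← s_mul_add hb N (b - 2) (by omega)]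
    congr 1
    rw [mul_add]
    omega

theorem s_mul_add_one {b : ℕ} (hb : 2 ≤ b) (N : ℕ) :
    s b (b * N + 1) = s b N + s b (N + 1) := by
  cases N with
  | zero => simp [s]
  | succ N =>
    rw [s_succ hb, s_succ hb, s_succ hb, words_mul hb, Set.ncard_union_eq ?_ ((words_finite hb _).image _)
        ((words_finite hb _).image _),
      Set.ncard_image_of_injective _ List.cons_injective,
      Set.ncard_image_of_injective _ List.cons_injective, add_comm]
    · rw [Set.disjoint_left]
      rintro _ ⟨L, -, rfl⟩ ⟨L', -, h⟩
      have := (List.cons.inj h).1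
      omega

theorem s_one (b : ℕ) : s b 1 = 1 := rfl

theorem s_two {b : ℕ} (hb : 2 ≤ b) : s b 2 = 1 := by
  simpa [s_one] using s_mul_add hb 0 0 (by omega)

/-! ### Fibonacci bounds -/

/-- Every natural number is `b N`, `b N + 1`, or `b N + e + 2` with `e + 2 < b`. -/
theorem exists_residue {b : ℕ} (hb : 2 ≤ b) (n : ℕ) :
    ∃ N, n = b * N ∨ n = b * N + 1 ∨ ∃ e, e + 2 < b ∧ n = b * N + e + 2 := by
  refine ⟨n / b, ?_⟩
  have h1 := Nat.div_add_mod n b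
  have h2 := Nat.mod_lt n (by omega : 0 < b)
  rcases h : n % b with _ | _ | e
  · left; omega
  · right; left; omega
  · right; right; exact ⟨e, by omega, by omega⟩

/-- The sum of two neighbours must be carried along, since it is the value at bN + 1 one level up.
-/
theorem s_le_fib_aux {b : ℕ} (hb : 2 ≤ b) (k : ℕ) : ∀ n < b ^ k,
    s b n ≤ Nat.fib (k + 1) ∧ s b (n + 1) ≤ Nat.fib (k + 1) ∧
      s b n + s b (n + 1) ≤ Nat.fib (k + 2) := by
  induction k with
  | zero =>
    intro n hn
    obtain rfl : n = 0 := by simpa using hn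
    simp [s]
  | succ k ih =>
    intro n hn
    obtain ⟨N, hN⟩ := exists_residue hb n
    have hNk : N < b ^ k := by
      have : b * N ≤ n := by
        rcases hN with h | h | ⟨e, -, h⟩ <;> omega
      rw [pow_succ'] at hn
      exact Nat.lt_of_mul_lt_mul_left (this.trans_lt hn)
    obtain ⟨h1, h2, h3⟩ := ih N hNk
    have f1 : Nat.fib (k + 1 + 1) = Nat.fib k + Nat.fib (k + 1) := Nat.fib_add_two
    have f2 : Nat.fib (k + 1 + 2) = Nat.fib (k + 1) + Nat.fib (k + 2) := Nat.fib_add_two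
    have f3 : Nat.fib (k + 2) = Nat.fib k + Nat.fib (k + 1) := Nat.fib_add_two
    rcases hN with rfl | rfl | ⟨e, he, rfl⟩
    · rw [s_mul_add_one hb, s_mul hb]
      omega
    · have := s_mul_add hb N 0 hb
      rw [show b * N + 1 + 1 = b * N + 0 + 2 by ring, this, s_mul_add_one hb]
      omega
    · have := s_mul_add hb N (e + 1) (by omega)
      rw [show b * N + e + 2 + 1 = b * N + (e + 1) + 2 by ring, this, s_mul_add hb N e (by omega)]
      omega

theorem s_le_fib {b k n : ℕ} (hb : 2 ≤ b) (hn : n ≤ b ^ k) : s b n ≤ Nat.fib (k + 1) := by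
  cases n with
  | zero => exact Nat.zero_le _
  | succ n => exact (s_le_fib_aux hb k n hn).2.1

/-! ### Linearity on blocks -/

/-- Both sides obey the same recurrences in v; v and v + 1 are treated together because bN + 1
involves N and N + 1. As s(1) = s(2) = 1, the coefficient of s(q) is s(b^j + v) - s(v), moved across
to avoid subtraction. -/
theorem s_split_aux {b : ℕ} (hb : 2 ≤ b) (q j : ℕ) : ∀ v < b ^ j,
    (s b (q * b ^ j + v) + s b q * s b v = s b q * s b (b ^ j + v) + s b (q + 1) * s b v) ∧
    (s b (q * b ^ j + (v + 1)) + s b q * s b (v + 1) =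
      s b q * s b (b ^ j + (v + 1)) + s b (q + 1) * s b (v + 1)) := by
  induction j with
  | zero =>
    intro v hv
    obtain rfl : v = 0 := by simpa using hv
    have s0 : s b 0 = 0 := rfl
    simp only [pow_zero, mul_one, add_zero, zero_add, s0, s_one, mul_zero, s_two hb,
      Nat.reduceAdd, true_and]
    ring
  | succ j ih =>
    intro v hv
    obtain ⟨N, hN⟩ := exists_residue hb v
    have hNk : N < b ^ j := by
      have : b * N ≤ v := by
        rcases hN with h | h | ⟨e, -, h⟩ <;> omega
      rw [pow_succ'] at hv
      exact Nat.lt_of_mul_lt_mul_left (this.trans_lt hv)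
    obtain ⟨h1, h2⟩ := ih N hNk
    have e1 (p : ℕ) : p * b ^ (j + 1) + b * N = b * (p * b ^ j + N) := by ring
    have e2 : b ^ (j + 1) + b * N = b * (b ^ j + N) := by ring
    have A : s b (q * b ^ (j + 1) + b * N) + s b q * s b (b * N) =
        s b q * s b (b ^ (j + 1) + b * N) + s b (q + 1) * s b (b * N) := by
      rw [e1, e2, s_mul hb, s_mul hb, s_mul hb, h1]
    have B : s b (q * b ^ (j + 1) + (b * N + 1)) + s b q * s b (b * N + 1) =
        s b q * s b (b ^ (j + 1) + (b * N + 1)) + s b (q + 1) * s b (b * N + 1) := by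
      rw [← add_assoc, ← add_assoc, e1, e2, s_mul_add_one hb, s_mul_add_one hb, s_mul_add_one hb]
      simp only [add_assoc]
      linarith
    have C (e : ℕ) (he : e + 2 ≤ b) :
        s b (q * b ^ (j + 1) + (b * N + e + 2)) + s b q * s b (b * N + e + 2) =
        s b q * s b (b ^ (j + 1) + (b * N + e + 2)) + s b (q + 1) * s b (b * N + e + 2) := by
      rw [show q * b ^ (j + 1) + (b * N + e + 2) = b * (q * b ^ j + N) + e + 2 by ring,
        show b ^ (j + 1) + (b * N + e + 2) = b * (b ^ j + N) + e + 2 by ring,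
        s_mul_add hb _ e he, s_mul_add hb _ e he, s_mul_add hb _ e he]
      simp only [add_assoc]
      exact h2
    rcases hN with rfl | rfl | ⟨e, he, rfl⟩
    · exact ⟨A, B⟩
    · exact ⟨B, C 0 hb⟩
    · exact ⟨C e (by omega), C (e + 1) (by omega)⟩

/-- The values of `s b` on a block of length `b ^ j` depend linearly on its two boundary data. -/
theorem s_split {b q j v : ℕ} (hb : 2 ≤ b) (hv : v ≤ b ^ j) :
    s b (q * b ^ j + v) + s b q * s b v = s b q * s b (b ^ j + v) + s b (q + 1) * s b v := by
  cases v with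
  | zero =>
    exact (s_split_aux hb q j 0 (by positivity)).1
  | succ v => exact (s_split_aux hb q j v hv).2

theorem s_pow {b : ℕ} (hb : 2 ≤ b) (k : ℕ) : s b (b ^ k) = 1 ∧ s b (b ^ k + 1) = k + 1 := by
  induction k with
  | zero => exact ⟨by simp [s_one], by simp [s_two hb]⟩
  | succ k ih =>
    rw [pow_succ', s_mul hb, s_mul_add_one hb, ih.1, ih.2]
    omega

theorem s_pow_add {b j t : ℕ} (hb : 2 ≤ b) (l : ℕ) (ht : t ≤ b ^ j) :
    s b (b ^ (j + l) + t) = s b (b ^ j + t) + l * s b t := by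
  have h := s_split (q := b ^ l) hb ht
  rw [(s_pow hb l).1, (s_pow hb l).2] at h
  rw [add_comm j l, pow_add]
  linarith

theorem s_pow_add_le {b j v : ℕ} (hb : 2 ≤ b) (hv : v ≤ b ^ j) :
    s b (b ^ j + v) ≤ Nat.fib (j + 2) := by
  refine s_le_fib (k := j + 1) hb ?_
  have : 2 * b ^ j ≤ b * b ^ j := Nat.mul_le_mul_right _ hb
  rw [pow_succ']
  omega

/-! ### Values at repunits in base b^2 -/

/-- `1 + b ^ 2 + ⋯ + b ^ (2 i)`. -/
def evenRepunit (b i : ℕ) : ℕ := ∑ l ∈ Finset.range (i + 1), b ^ (2 * l)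

theorem evenRepunit_zero (b : ℕ) : evenRepunit b 0 = 1 := by simp [evenRepunit]

theorem evenRepunit_succ (b i : ℕ) :
    evenRepunit b (i + 1) = b * (b * evenRepunit b i) + 1 := by
  rw [evenRepunit, Finset.sum_range_succ', evenRepunit, Finset.mul_sum, Finset.mul_sum]
  congr 1
  refine Finset.sum_congr rfl fun l _ => ?_
  ring

theorem evenRepunit_succ' (b i : ℕ) :
    evenRepunit b (i + 1) = evenRepunit b i + b ^ (2 * i + 2) := by
  rw [evenRepunit, Finset.sum_range_succ, ← evenRepunit]
  rfl

theorem s_evenRepunit {b : ℕ} (hb : 2 ≤ b) (i : ℕ) :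
    s b (evenRepunit b i) = Nat.fib (2 * i + 2) ∧
      s b (evenRepunit b i + 1) = Nat.fib (2 * i + 1) := by
  induction i with
  | zero => simp [evenRepunit_zero, s_one, s_two hb]
  | succ i ih =>
    have f1 : Nat.fib (2 * i + 3) = Nat.fib (2 * i + 1) + Nat.fib (2 * i + 2) := Nat.fib_add_two
    have f2 : Nat.fib (2 * i + 4) = Nat.fib (2 * i + 2) + Nat.fib (2 * i + 3) := Nat.fib_add_two
    have h := s_mul_add hb (b * evenRepunit b i) 0 hb
    rw [evenRepunit_succ, s_mul_add_one hb, s_mul hb, s_mul_add_one hb, ih.1, ih.2,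
      show b * (b * evenRepunit b i) + 1 + 1 = b * (b * evenRepunit b i) + 0 + 2 by ring, h,
      s_mul_add_one hb, ih.1, ih.2]
    constructor
    · rw [show 2 * (i + 1) + 2 = 2 * i + 4 by ring]; omega
    · rw [show 2 * (i + 1) + 1 = 2 * i + 3 by ring]; omega

theorem s_evenRepunit_mul_pow {b j v : ℕ} (hb : 2 ≤ b) (i l : ℕ) (hv : v ≤ b ^ j) :
    s b (evenRepunit b i * b ^ (j + l) + v) + Nat.fib (2 * i + 2) * s b v =
      Nat.fib (2 * i + 2) * s b (b ^ j + v) +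
        (Nat.fib (2 * i + 1) + l * Nat.fib (2 * i + 2)) * s b v := by
  have h := s_split (q := evenRepunit b i * b ^ l) hb hv
  have key (l : ℕ) : s b (evenRepunit b i * b ^ l) = Nat.fib (2 * i + 2) ∧
      s b (evenRepunit b i * b ^ l + 1) = Nat.fib (2 * i + 1) + l * Nat.fib (2 * i + 2) := by
    induction l with
    | zero => simpa using s_evenRepunit hb i
    | succ l ih =>
      rw [show evenRepunit b i * b ^ (l + 1) = b * (evenRepunit b i * b ^ l) by ring,
        s_mul_add_one hb, s_mul hb, ih.1, ih.2]
      exact ⟨rfl, by ring⟩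
  rw [(key l).1, (key l).2] at h
  rw [← h]
  congr 2
  ring

/-! ### The numbers h_m and their gaps -/

theorem h_two (b : ℕ) : h b 2 = 1 := by simp [h]

theorem h_three (b : ℕ) : h b 3 = 1 + b := by simp [h]

theorem h_add_two (b m : ℕ) : h b (m + 4) = b ^ (m + 2) + h b (m + 2) := by
  rcases m with _ | m
  · simp [h]; omega
  · have e : (m + 1 + 4 - 3) / 2 + 1 = ((m + 1 + 2 - 3) / 2 + 1) + 1 := by omega
    rw [h, h, if_neg (by omega), if_neg (by omega), e, Finset.sum_range_succ']
    have : ∀ i, m + 1 + 4 - 2 - 2 * (i + 1) = m + 1 + 2 - 2 - 2 * i := by intro i; omega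
    simp only [this]
    rw [show m + 1 + 4 - 2 - 2 * 0 = m + 1 + 2 by omega]
    ring

/-- `h_{j+2} = e_j + 1` where `e_j = b^j + b^(j-2) + ⋯` with positive exponents. -/
def hTail (b : ℕ) : ℕ → ℕ
  | 0 => 0
  | 1 => b
  | j + 2 => b ^ (j + 2) + hTail b j

theorem h_eq_hTail (b : ℕ) : ∀ j, h b (j + 2) = hTail b j + 1
  | 0 => by simp [hTail, h_two]
  | 1 => by simp [hTail, h_three, add_comm]
  | j + 2 => by
    rw [h_add_two, h_eq_hTail b j, hTail, add_assoc]

theorem hTail_add_hTail_succ_lt {b : ℕ} (hb : 2 ≤ b) (j : ℕ) :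
    hTail b j + hTail b (j + 1) < b ^ (j + 2) := by
  induction j with
  | zero =>
    have : 2 * b ≤ b * b := Nat.mul_le_mul_right _ hb
    simp only [hTail, zero_add, pow_two]
    omega
  | succ j ih =>
    calc hTail b (j + 1) + hTail b (j + 2)
        = b ^ (j + 2) + (hTail b j + hTail b (j + 1)) := by rw [hTail]; ring
      _ < b ^ (j + 2) + b ^ (j + 2) := by gcongr
      _ = 2 * b ^ (j + 2) := by ring
      _ ≤ b * b ^ (j + 2) := Nat.mul_le_mul_right _ hb
      _ = b ^ (j + 1 + 2) := by ring

theorem hTail_lt {b : ℕ} (hb : 2 ≤ b) (j : ℕ) : hTail b j < b ^ (j + 1) := by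
  cases j with
  | zero => simp only [hTail]; positivity
  | succ j => exact (Nat.le_add_left _ _).trans_lt (hTail_add_hTail_succ_lt hb j)

theorem hTail_succ_add_two_mul_lt {b : ℕ} (hb : 2 ≤ b) : ∀ j,
    hTail b (j + 2) + 2 * hTail b (j + 1) < b ^ (j + 3) + 3 * b ^ j
  | 0 => by
    simp only [hTail]
    norm_num
    nlinarith [mul_le_mul hb hb (by omega) (by omega), pow_succ' b 2]
  | 1 => by
    simp only [hTail]
    norm_num
    obtain ⟨c, rfl⟩ := Nat.exists_eq_add_of_le hb
    ring_nf
    nlinarith [sq_nonneg c, pow_nonneg (Nat.zero_le c) 3, pow_nonneg (Nat.zero_le c) 4]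
  | j + 2 => by
    have ih := hTail_succ_add_two_mul_lt hb j
    -- Times b^j, this compares the increments of the two sides from j to j + 2.
    have key : b ^ 4 + 3 * b ^ 3 + 3 ≤ b ^ 5 + 3 * b ^ 2 := by
      obtain ⟨c, rfl⟩ := Nat.exists_eq_add_of_le hb
      ring_nf
      nlinarith [pow_nonneg (Nat.zero_le c) 3, pow_nonneg (Nat.zero_le c) 4,
        pow_nonneg (Nat.zero_le c) 5]
    have := Nat.mul_le_mul_left (b ^ j) key
    rw [show hTail b (j + 2 + 2) = b ^ (j + 2 + 2) + hTail b (j + 2) from rfl,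
      show hTail b (j + 2 + 1) = b ^ (j + 1 + 2) + hTail b (j + 1) from rfl]
    ring_nf at this ih ⊢
    omega

theorem two_mul_hTail_lt {b : ℕ} (hb : 2 ≤ b) (j i : ℕ) :
    2 * hTail b j + hTail b (j + 2 * i + 1) < hTail b (j + 2 * i + 2) := by
  induction i with
  | zero =>
    have := hTail_add_hTail_succ_lt hb j
    rw [show hTail b (j + 2 * 0 + 2) = b ^ (j + 2) + hTail b j from rfl, mul_zero, add_zero]
    omega
  | succ i ih =>
    have : b ^ (j + 2 * i + 3) ≤ b ^ (j + 2 * i + 4) :=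
      Nat.pow_le_pow_right (by omega) (by omega)
    rw [show hTail b (j + 2 * (i + 1) + 1) = b ^ (j + 2 * i + 3) + hTail b (j + 2 * i + 1) from rfl,
      show hTail b (j + 2 * (i + 1) + 2) = b ^ (j + 2 * i + 4) + hTail b (j + 2 * i + 2) from rfl]
    omega

theorem five_mul_hTail_lt {b : ℕ} (hb : 2 ≤ b) (j i : ℕ) :
    5 * hTail b j + hTail b (j + 2 * (i + 1) + 1) < hTail b (j + 2 * (i + 1) + 2) := by
  have h1 := two_mul_hTail_lt hb j i
  have h2 : 2 * b ^ (j + 2 * i + 3) ≤ b ^ (j + 2 * i + 4) := by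
    rw [pow_succ' b (j + 2 * i + 3)]
    exact Nat.mul_le_mul_right _ hb
  have h3 : 4 * b ^ (j + 1) ≤ b ^ (j + 2 * i + 3) := by
    calc 4 * b ^ (j + 1) ≤ b ^ 2 * b ^ (j + 1) := by
          refine Nat.mul_le_mul_right _ ?_
          nlinarith
      _ = b ^ (j + 3) := by ring
      _ ≤ _ := Nat.pow_le_pow_right (by omega) (by omega)
  have h4 := hTail_lt hb j
  rw [show hTail b (j + 2 * (i + 1) + 1) = b ^ (j + 2 * i + 3) + hTail b (j + 2 * i + 1) from rfl,
    show hTail b (j + 2 * (i + 1) + 2) = b ^ (j + 2 * i + 4) + hTail b (j + 2 * i + 2) from rfl]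
  omega

theorem hTail_eq_evenRepunit (b j i : ℕ) :
    hTail b (j + 2 * i + 2) = evenRepunit b i * b ^ (j + 2) + hTail b j := by
  induction i with
  | zero => simp [evenRepunit_zero, hTail]
  | succ i ih =>
    rw [show hTail b (j + 2 * (i + 1) + 2) = b ^ (j + 2 * i + 4) + hTail b (j + 2 * i + 2) from rfl,
      ih, evenRepunit_succ']
    ring

/-- The powers making up `hTail b (M + 1)` are subtracted from t while the remainder exceeds the
next one; the last one removed is b^(p+3). For M = 0, 1 the range of t is empty. -/
theorem exists_eq_evenRepunit_mul_add (b : ℕ) : ∀ M t, b ^ (M + 1) < t → t ≤ hTail b (M + 1) →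
    ∃ i p v, M = p + 2 * i + 2 ∧ t = evenRepunit b i * b ^ (p + 3) + v ∧ 0 < v ∧ v ≤ b ^ (p + 1)
  | 0, t, h1, h2 => by simp [hTail] at h1 h2; omega
  | 1, t, h1, h2 => by simp [hTail] at h1 h2; omega
  | M + 2, t, h1, h2 => by
    obtain ⟨u, rfl⟩ := Nat.exists_eq_add_of_lt h1
    rw [show hTail b (M + 2 + 1) = b ^ (M + 2 + 1) + hTail b (M + 1) from rfl] at h2
    rcases le_or_gt (u + 1) (b ^ (M + 1)) with h3 | h3
    · exact ⟨0, M, u + 1, rfl, by rw [evenRepunit_zero]; ring, by omega, h3⟩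
    · obtain ⟨i, p, v, rfl, h5, h6, h7⟩ :=
        exists_eq_evenRepunit_mul_add b M (u + 1) h3 (by omega)
      refine ⟨i + 1, p, v, by ring, ?_, h6, h7⟩
      rw [add_assoc, h5, evenRepunit_succ']
      ring

/-! ### Comparison with the line -/

/-- At distance w left of its right end, a line of slope f/d and final height T has dropped by f w /
d ≤ D c w / d < D, whereas S is at least D below T. -/
theorem mul_add_mul_lt_mul {S T f D c w d : ℤ} (hS : S + D ≤ T) (hD : 0 < D) (hf : f ≤ c * D)
    (hc : 0 ≤ c) (hw : 0 ≤ w) (hcw : c * w < d) : S * d + f * w < T * d := by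
  have hd : 0 ≤ d := (mul_nonneg hc hw).trans hcw.le
  have h1 := mul_le_mul_of_nonneg_right hS hd
  have h2 := mul_le_mul_of_nonneg_right hf hw
  have h3 := mul_lt_mul_of_pos_left hcw hD
  linarith

theorem fib_two_mul_add_le (i p : ℕ) :
    Nat.fib (2 * i + p + 3) ≤ 5 * (Nat.fib (2 * i + 1) * Nat.fib (p + 1)) := by
  have h1 : Nat.fib (2 * i + p + 3) =
      Nat.fib (2 * i + 2) * Nat.fib p + Nat.fib (2 * i + 3) * Nat.fib (p + 1) := by
    rw [← Nat.fib_add]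
    congr 1
    ring
  have h2 : Nat.fib p ≤ Nat.fib (p + 1) := Nat.fib_le_fib_succ
  have f1 : Nat.fib (2 * i + 2) = Nat.fib (2 * i) + Nat.fib (2 * i + 1) := Nat.fib_add_two
  have f2 : Nat.fib (2 * i + 3) = Nat.fib (2 * i + 1) + Nat.fib (2 * i + 2) := Nat.fib_add_two
  have f3 : Nat.fib (2 * i) ≤ Nat.fib (2 * i + 1) := Nat.fib_le_fib_succ
  have h3 := Nat.mul_le_mul_left (Nat.fib (2 * i + 2)) h2
  have h4 : (Nat.fib (2 * i + 2) + Nat.fib (2 * i + 3)) * Nat.fib (p + 1) ≤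
      (5 * Nat.fib (2 * i + 1)) * Nat.fib (p + 1) := Nat.mul_le_mul_right _ (by omega)
  linarith

/-- The value is F_{2i+2} s(b^j + v) + F_{2i+3} s(v), at most F_{2i+2} F_{j+2} + F_{2i+3} F_{j+1}.
The addition formula for F_{2i+j+4} pairs these factors the other way; the difference is (F_{2i+3} -
F_{2i+2})(F_{j+2} - F_{j+1}). -/
theorem s_evenRepunit_mul_pow_add_le {b j v : ℕ} (hb : 2 ≤ b) (i : ℕ) (hv : v ≤ b ^ j) :
    s b (evenRepunit b i * b ^ (j + 2) + v) + Nat.fib (2 * i + 1) * Nat.fib j ≤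
      Nat.fib (2 * i + j + 4) := by
  have h1 : Nat.fib (2 * i + j + 4) =
      Nat.fib (2 * i + 2) * Nat.fib (j + 1) + Nat.fib (2 * i + 3) * Nat.fib (j + 2) := by
    rw [← Nat.fib_add]
    congr 1
    ring
  have h2 := s_evenRepunit_mul_pow hb i 2 hv
  have f1 : Nat.fib (2 * i + 3) = Nat.fib (2 * i + 1) + Nat.fib (2 * i + 2) := Nat.fib_add_two
  have f2 : Nat.fib (j + 2) = Nat.fib j + Nat.fib (j + 1) := Nat.fib_add_two
  have h3 := Nat.mul_le_mul_left (Nat.fib (2 * i + 2)) (s_pow_add_le hb hv)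
  have h4 := Nat.mul_le_mul_left (Nat.fib (2 * i + 3)) (s_le_fib hb hv)
  rw [f1] at h1 h4
  rw [f2] at h1 h3
  linarith

theorem s_block_lt {b p i v : ℕ} (hb : 2 ≤ b) (hv0 : 0 < v) (hv : v ≤ b ^ (p + 1))
    (hv' : v ≤ hTail b (p + 1)) :
    (s b (evenRepunit b i * b ^ (p + 3) + v) : ℤ) *
        (hTail b (p + 1 + 2 * i + 2) - hTail b (p + 1 + 2 * i + 1)) +
      Nat.fib (2 * i + p + 3) * (hTail b (p + 1) + 1 - v) <
    Nat.fib (2 * i + p + 5) * (hTail b (p + 1 + 2 * i + 2) - hTail b (p + 1 + 2 * i + 1)) := by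
  have hp : 0 < Nat.fib (p + 1) := Nat.fib_pos.2 (by omega)
  have f2 : Nat.fib (p + 2) = Nat.fib p + Nat.fib (p + 1) := Nat.fib_add_two
  have f3 : Nat.fib (p + 3) = Nat.fib (p + 1) + Nat.fib (p + 2) := Nat.fib_add_two
  have f4 : Nat.fib (p + 4) = Nat.fib (p + 2) + Nat.fib (p + 3) := Nat.fib_add_two
  have f5 : Nat.fib (p + 5) = Nat.fib (p + 3) + Nat.fib (p + 4) := Nat.fib_add_two
  have hf : Nat.fib p ≤ Nat.fib (p + 1) := Nat.fib_le_fib_succ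
  have hmain := s_evenRepunit_mul_pow_add_le hb i hv
  rcases i with _ | i
  · simp only [mul_zero, zero_add, add_zero]
    rcases le_or_gt v (b ^ p) with hvp | hvp
    -- For i = 0 the gap only gives c = 2, but small v leaves one more empty place: F_{p+2} + 3
    -- F_{p+1} falls short of F_{p+5} by F_{p+1} + 2 F_p.
    · have h1 := s_pow_add hb 3 hvp
      have h2 := s_pow_add_le hb hvp
      have h3 := s_le_fib hb hvp
      have h4 := two_mul_hTail_lt hb (p + 1) 0
      simp only [mul_zero, add_zero] at h4
      rw [evenRepunit_zero, one_mul]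
      refine mul_add_mul_lt_mul (D := Nat.fib (p + 1) + 2 * Nat.fib p) (c := 2) ?_ ?_ ?_ ?_ ?_ ?_
        <;> omega
    -- The general deficit F_{p+1} now needs c = 3; this is affordable because v > b^p shortens the
    -- distance to the right end.
    · have h4 := hTail_succ_add_two_mul_lt hb p
      have h5 : hTail b (p + 1 + 2) = b ^ (p + 3) + hTail b (p + 1) := rfl
      simp only [mul_zero, zero_add, Nat.fib_one, one_mul] at hmain
      rw [show p + 1 + 4 = p + 5 by ring, show p + 1 + 2 = p + 3 by ring] at hmain
      rw [show p + 1 + 1 = p + 2 by ring]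
      refine mul_add_mul_lt_mul (D := Nat.fib (p + 1)) (c := 3) ?_ ?_ ?_ ?_ ?_ ?_ <;> omega
  · have h4 := five_mul_hTail_lt hb (p + 1) i
    have h5 := fib_two_mul_add_le (i + 1) p
    have h6 : 0 < Nat.fib (2 * (i + 1) + 1) * Nat.fib (p + 1) :=
      Nat.mul_pos (Nat.fib_pos.2 (by omega)) hp
    refine mul_add_mul_lt_mul (D := (Nat.fib (2 * (i + 1) + 1) * Nat.fib (p + 1) : ℕ)) (c := 5)
      ?_ ?_ ?_ ?_ ?_ ?_
    · exact_mod_cast hmain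
    · exact_mod_cast h6
    · exact_mod_cast h5
    all_goals omega

/-- Between `h_m` and `h_{m+1}`, with `m = M + 2`, the sequence `s b` lies below the line through
`(h_m, F_m)` and `(h_{m+1}, F_{m+1})`. -/
theorem s_lt_line {b M t : ℕ} (hb : 2 ≤ b) (h1 : h b (M + 2) < t) (h2 : t < h b (M + 3)) :
    (s b t : ℤ) * (h b (M + 3) - h b (M + 2)) + Nat.fib (M + 1) * (h b (M + 3) - t) <
      Nat.fib (M + 3) * (h b (M + 3) - h b (M + 2)) := by
  have e1 := h_eq_hTail b M
  have e2 : h b (M + 3) = hTail b (M + 1) + 1 := h_eq_hTail b (M + 1)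
  have f3 : Nat.fib (M + 3) = Nat.fib (M + 1) + Nat.fib (M + 2) := Nat.fib_add_two
  rcases le_or_gt t (b ^ (M + 1)) with h3 | h3
  -- Here s(t) is at most the height of the left end, and the line has positive slope.
  · have h4 : (s b t : ℤ) ≤ Nat.fib (M + 2) := by exact_mod_cast s_le_fib hb h3
    have h5 : (0 : ℤ) < Nat.fib (M + 1) := by exact_mod_cast Nat.fib_pos.2 (by omega)
    have h6 : (0 : ℤ) < h b (M + 3) - h b (M + 2) := by omega
    have h7 : (0 : ℤ) < t - h b (M + 2) := by omega
    have h8 := mul_le_mul_of_nonneg_right h4 h6.le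
    have h9 := mul_pos h5 h7
    rw [f3]
    push_cast
    linarith
  · obtain ⟨i, p, v, rfl, rfl, hv0, hv⟩ := exists_eq_evenRepunit_mul_add b M t h3 (by omega)
    have h4 := hTail_eq_evenRepunit b (p + 1) i
    rw [show p + 2 * i + 2 + 1 = p + 1 + 2 * i + 2 by ring] at e2
    rw [show p + 2 * i + 2 = p + 1 + 2 * i + 1 by ring] at e1
    rw [show p + 1 + 2 = p + 3 by ring] at h4
    have h5 := s_block_lt (i := i) hb hv0 hv (by omega)
    rw [show p + 2 * i + 2 + 3 = p + 1 + 2 * i + 2 + 2 by ring] at *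
    rw [show p + 2 * i + 2 + 2 = p + 1 + 2 * i + 1 + 2 by ring] at *
    rw [show p + 2 * i + 2 + 1 = 2 * i + p + 3 by ring,
      show p + 1 + 2 * i + 2 + 2 = 2 * i + p + 5 by ring]
    rw [show p + 1 + 2 * i + 2 + 2 = 2 * i + p + 5 by ring] at e2
    rw [e1, e2]
    push_cast
    zify at h4
    have h6 : (hTail b (p + 1 + 2 * i + 2) + 1 - (evenRepunit b i * b ^ (p + 3) + v) : ℤ) =
      hTail b (p + 1) + 1 - v := by rw [h4]; ring
    rw [h6]
    convert h5 using 2 <;> ring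

end SternBound

/-! ### The main theorem -/

theorem mainTheorem4 (b k m n : ℕ) (hb : 2 ≤ b) (hm : 2 ≤ m) (hmk : m < k)
    (hn₁ : SternBound.G b k m < n) (hn₂ : n < SternBound.G b k (m + 1)) :
    (SternBound.s b n : ℝ) < SternBound.J b k m (n : ℝ) := by
  open SternBound in
  obtain ⟨M, rfl⟩ := Nat.exists_eq_add_of_le' hm
  obtain ⟨l, rfl⟩ := Nat.exists_eq_add_of_lt hmk
  rw [G] at hn₁ hn₂
  obtain ⟨t, rfl⟩ := Nat.exists_eq_add_of_le
    (show b ^ (M + 2 + l + 1) ≤ n by omega)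
  have h1 : h b (M + 2) < t := by omega
  have h2 : t < h b (M + 3) := Nat.lt_of_add_lt_add_left hn₂
  have e2 : h b (M + 3) = hTail b (M + 1) + 1 := h_eq_hTail b (M + 1)
  have ht : t ≤ b ^ (M + 2) := by
    exact (Nat.lt_succ_iff.1 (h2.trans_eq e2)).trans (hTail_lt hb (M + 1)).le
  have h3 : (s b (b ^ (M + 2 + (l + 1)) + t) : ℝ) ≤ Nat.fib (M + 4) + (l + 1) * s b t := by
    rw [s_pow_add hb (l + 1) ht]
    have := s_pow_add_le hb ht
    push_cast
    gcongr
  have h4 : (s b t : ℝ) * (h b (M + 3) - h b (M + 2)) + Nat.fib (M + 1) * (h b (M + 3) - t) <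
      Nat.fib (M + 3) * (h b (M + 3) - h b (M + 2)) := by
    exact_mod_cast s_lt_line hb h1 h2
  have f3 : (Nat.fib (M + 3) : ℝ) = Nat.fib (M + 1) + Nat.fib (M + 2) := by
    exact_mod_cast Nat.fib_add_two
  have f5 : (Nat.fib (M + 5) : ℝ) = Nat.fib (M + 3) + Nat.fib (M + 4) := by
    exact_mod_cast Nat.fib_add_two
  have hd : (0 : ℝ) < h b (M + 3) - h b (M + 2) := by
    rw [sub_pos]
    exact_mod_cast h1.trans h2
  set d : ℝ := h b (M + 3) - h b (M + 2) with hd'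
  have hslope : (s b t : ℝ) < Nat.fib (M + 1) / d * (t - h b (M + 2)) + Nat.fib (M + 2) := by
    rw [div_mul_eq_mul_div, ← sub_lt_iff_lt_add, lt_div_iff₀ hd]
    rw [f3] at h4
    have : (t : ℝ) - h b (M + 2) = d - (h b (M + 3) - t) := by rw [hd']; ring
    rw [this]
    linarith
  have hl : (0 : ℝ) < l + 1 := by positivity
  have h5 := mul_lt_mul_of_pos_left hslope hl
  -- With k - m = l + 1, the right end has height F_{M+5} + l F_{M+3} = F_{M+4} + (l+1) F_{M+3}, so
  -- both ends share the constant F_{M+4}.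
  have hJ : J b (M + 2 + l + 1) (M + 2) ((b ^ (M + 2 + l + 1) + t : ℕ) : ℝ) =
      Nat.fib (M + 4) +
        (l + 1) * (Nat.fib (M + 1) / d * (t - h b (M + 2)) + Nat.fib (M + 2)) := by
    have g : ((G b (M + 2 + l + 1) (M + 2 + 1) : ℝ) - G b (M + 2 + l + 1) (M + 2)) = d := by
      rw [G, G, hd', show M + 2 + 1 = M + 3 from rfl]
      push_cast
      ring
    have hH : ((H (M + 2 + l + 1) (M + 2 + 1) : ℝ) - H (M + 2 + l + 1) (M + 2)) =
        (l + 1) * Nat.fib (M + 1) := by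
      rw [H, H, show M + 2 + 1 + 2 = M + 5 from rfl, show M + 2 + 1 = M + 3 from rfl,
        show M + 2 + 2 = M + 4 from rfl]
      push_cast
      rw [f5, f3]
      ring
    rw [J, g, hH, G, H, show M + 2 + 2 = M + 4 from rfl]
    push_cast
    ring
  rw [hJ]
  exact h3.trans_lt (by linarith)
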